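/- Let $\mathcal{T}$ be either the category of topological spaces and continuous maps, with ordinary homotopies, or the category of well-pointed topological spaces (the inclusion of the base point is a closed cofibration) and base-point-preserving continuous maps, with homotopies that are stationary at the base point. Write $\simeq$ for homotopy of maps in $\mathcal{T}$. A square $$f\circ q\simeq \iota\circ p,\qquad q\colon P\to X,\quad p\colon P\to A,\quad f\colon X\to Y,\quad \iota\colon A\to Y$$ in $\mathcal{T}$ is a homotopy pullback if, for some homotopy $H$ from $f\circ q$ to $\iota\circ p$, the map $z\mapsto (q(z),H(-,z),p(z))$ from $P$ to the space of triples $(x,\gamma,a)\in X\times Y^{[0,1]}\times A$ with $\gamma(0)=f(x)$ and $\gamma(1)=\iota(a)$ is a homotopy equivalence in $\mathcal{T}$. Let $\mathrm{secat}$ be an abstract sectional category on $\mathcal{T}$, that is, a function that assigns to each map $\iota\colon A\to Y$ of $\mathcal{T}$ a value $\mathrm{secat}(\iota)\in\{0,1,2,\dots\}\cup\{\infty\}$ such that: - (S0) $\mathrm{secat}(\iota)=0$ if and only if there is a map $s\colon Y\to A$ in $\mathcal{T}$ with $\iota\circ s\simeq \mathrm{id}_Y$; - (S1) if $\iota\colon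 A\to X$, $\kappa\colon B\to X$ and $\zeta\colon B\to A$ are maps in $\mathcal{T}$ with $\iota\circ\zeta\simeq\kappa$, then $\mathrm{secat}(\iota)\le\mathrm{secat}(\kappa)$; - (S2) for every homotopy pullback as above, $\mathrm{secat}(q)\le\mathrm{secat}(\iota)$. For maps $f\colon X\to Y$ and $\iota\colon A\to Y$ in $\mathcal{T}$, let $\mathrm{liftcat}_f(\iota)=\mathrm{secat}(q)$, where $q\colon P\to X$ is the map of a homotopy pullback of $f$ and $\iota$ (by (S1) the choice does not matter). For maps $f,g\colon X\to Y$ in $\mathcal{T}$, the homotopic distance is $D(f,g)=\mathrm{liftcat}_{(f,g)}(\Delta)$, where $(f,g)\colon X\to Y\times Y$ and $\Delta\colon Y\to Y\times Y$ is the diagonal. Then, for all maps $f,g\colon X\to Y$ in $\mathcal{T}$: 1. $D(f,g)=0$ if and only if $f\simeq g$; 2. $D(f,g)=D(g,f)$. -/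

import Mathlib

open scoped unitInterval ContinuousMap

universe u

noncomputable section

namespace LiftCat

/-! ### Homotopy pullbacks and abstract sectional category for topological spaces -/

section Free

variable {X Y A P : Type u} [TopologicalSpace X] [TopologicalSpace Y] [TopologicalSpace A]
  [TopologicalSpace P]

/-- The standard homotopy pullback of `f : X → Y` and `ι : A → Y`: the space of triples
`(x, γ, a)` where `γ` is a path in `Y` from `f x` to `ι a`. -/
abbrev StdPullback (f : C(X, Y)) (ι : C(A, Y)) : Type u :=
  {z : X × C(I, Y) × A // z.2.1 0 = f z.1 ∧ z.2.1 1 = ι z.2.2}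

/-- The projection of the standard homotopy pullback to `X`. -/
def StdPullback.fst (f : C(X, Y)) (ι : C(A, Y)) : C(StdPullback f ι, X) where
  toFun z := z.1.1

/-- A homotopy `H` from `f ∘ q` to `ι ∘ p` induces a map into the standard homotopy pullback,
`z ↦ (q z, H(-, z), p z)`. -/
def whisker {f : C(X, Y)} {ι : C(A, Y)} {q : C(P, X)} {p : C(P, A)}
    (H : (f.comp q).Homotopy (ι.comp p)) : C(P, StdPullback f ι) where
  toFun z := ⟨(q z, ⟨fun t => H (t, z), by fun_prop⟩, p z), by simp, by simp⟩
  continuous_toFun := by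
    refine Continuous.subtype_mk (q.continuous.prodMk (Continuous.prodMk ?_ p.continuous)) _
    refine ContinuousMap.continuous_of_continuous_uncurry _ ?_
    exact H.continuous.comp (continuous_snd.prodMk continuous_fst)

/-- The square with sides `q : P → X`, `p : P → A`, `f : X → Y`, `ι : A → Y` is a homotopy
pullback: it commutes up to a homotopy for which the induced map from `P` to the standard homotopy
pullback is a homotopy equivalence. -/
def IsHomotopyPullback (q : C(P, X)) (p : C(P, A)) (f : C(X, Y)) (ι : C(A, Y)) : Prop :=
  ∃ (H : (f.comp q).Homotopy (ι.comp p)) (e : P ≃ₕ StdPullback f ι), e.toFun = whisker H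

end Free

/-- An abstract sectional category on topological spaces and continuous maps. -/
structure SectionalCategory where
  /-- the number attached to each map -/
  secat : ∀ {A Y : Type u} [TopologicalSpace A] [TopologicalSpace Y], C(A, Y) → ℕ∞
  /-- S0: it vanishes exactly on the maps with a homotopy section. -/
  secat_eq_zero_iff : ∀ {A Y : Type u} [TopologicalSpace A] [TopologicalSpace Y] (ι : C(A, Y)),
    secat ι = 0 ↔ ∃ s : C(Y, A), (ι.comp s).Homotopic (ContinuousMap.id Y)
  /-- S1: monotonicity over a fixed base. -/
  secat_le_of_triangle : ∀ {A B X : Type u} [TopologicalSpace A] [TopologicalSpace B]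
    [TopologicalSpace X] (ι : C(A, X)) (κ : C(B, X)) (ζ : C(B, A)),
    (ι.comp ζ).Homotopic κ → secat ι ≤ secat κ
  /-- S2: monotonicity under base change. -/
  secat_le_of_isHomotopyPullback : ∀ {P X Y A : Type u} [TopologicalSpace P] [TopologicalSpace X]
    [TopologicalSpace Y] [TopologicalSpace A] (q : C(P, X)) (p : C(P, A)) (f : C(X, Y))
    (ι : C(A, Y)), IsHomotopyPullback q p f ι → secat q ≤ secat ι

namespace SectionalCategory

variable (S : SectionalCategory.{u}) {X Y A P : Type u} [TopologicalSpace X] [TopologicalSpace Y]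
  [TopologicalSpace A] [TopologicalSpace P]

/-- The lifting category from `f` to `ι`: the sectional category of the base change of `ι`
along `f` in the standard homotopy pullback. -/
def liftcat (f : C(X, Y)) (ι : C(A, Y)) : ℕ∞ := S.secat (StdPullback.fst f ι)

/-- The lifting category may be computed with any homotopy pullback. -/
theorem liftcat_eq_secat {q : C(P, X)} {p : C(P, A)} {f : C(X, Y)} {ι : C(A, Y)}
    (h : IsHomotopyPullback q p f ι) : S.liftcat f ι = S.secat q := by
  obtain ⟨H, e, he⟩ := h
  have hq : (StdPullback.fst f ι).comp e.toFun = q := by rw [he]; rfl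
  refine le_antisymm (S.secat_le_of_triangle _ _ e.toFun (hq ▸ .refl _))
    (S.secat_le_of_triangle _ _ e.invFun ?_)
  have := (ContinuousMap.Homotopic.refl (StdPullback.fst f ι)).comp e.right_inv
  rwa [← ContinuousMap.comp_assoc, hq, ContinuousMap.comp_id] at this

/-- The homotopic distance, i.e. the lifting category from `(f, g) : X → Y × Y` to the diagonal. -/
def homDist (f g : C(X, Y)) : ℕ∞ :=
  S.liftcat (f.prodMk g) ((ContinuousMap.id Y).prodMk (ContinuousMap.id Y))

end SectionalCategory

/-! ### Well-pointed spaces -/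

/-- Homotopy extension property of `i : A → X`. -/
def IsCofibration {A X : Type u} [TopologicalSpace A] [TopologicalSpace X] (i : C(A, X)) : Prop :=
  ∀ (Z : Type u) [TopologicalSpace Z] (g : C(X, Z)) (H : C(I × A, Z)),
    (∀ a, H (0, a) = g (i a)) →
    ∃ G : C(I × X, Z), (∀ x, G (0, x) = g x) ∧ ∀ t a, G (t, i a) = H (t, a)

/-- The inclusion of the point `x₀` in `X` is a closed cofibration. -/
def IsWellPointed {X : Type u} [TopologicalSpace X] (x₀ : X) : Prop :=
  IsClosed ({x₀} : Set X) ∧ IsCofibration (ContinuousMap.const PUnit.{u + 1} x₀)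

/-- A well-pointed space is one whose base point has a halo function `v` and a deformation `h` which brings
`x` to the base point by the time `v x`. -/
theorem isWellPointed_iff {X : Type u} [TopologicalSpace X] (x₀ : X) :
    IsWellPointed x₀ ↔ ∃ (v : C(X, ℝ)) (h : C(I × X, X)), v x₀ = 0 ∧ (∀ x, 0 ≤ v x) ∧
      (∀ x, h (0, x) = x) ∧ ∀ (t : I) x, v x ≤ t → h (t, x) = x₀ := by
  constructor
  · rintro ⟨hc, hcof⟩
    obtain ⟨G, hG0, hG1⟩ := hcof {z : I × X // z.1 = 0 ∨ z.2 = x₀} ⟨fun x => ⟨(0, x), .inl rfl⟩, by fun_prop⟩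
      ⟨fun z => ⟨(z.1, x₀), .inr rfl⟩, by fun_prop⟩ (fun a => rfl)
    have hG1' : ∀ t, G (t, x₀) = ⟨(t, x₀), .inr rfl⟩ := fun t => hG1 t PUnit.unit
    let F : C(X, C(I, ℝ)) := ContinuousMap.curry
      ⟨fun z : X × I => (z.2 : ℝ) - ((G (z.2, z.1)).1.1 : ℝ), by fun_prop⟩
    have hF : ∀ x t, F x t = (t : ℝ) - ((G (t, x)).1.1 : ℝ) := fun x t => rfl
    have key : ∀ (t : I) x, ‖F x‖ < t → (G (t, x)).1.2 = x₀ := by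
      intro t x htx
      rcases (G (t, x)).2 with h0 | h0
      · have h1 := (F x).norm_coe_le_norm t
        rw [hF, h0] at h1
        have := t.2.1
        simp [abs_of_nonneg this] at h1
        exact absurd htx (not_lt.2 h1)
      · exact h0
    have hzero : ∀ x, ‖F x‖ = 0 → x = x₀ := by
      intro x hx
      have hcl : IsClosed {t : I | (G (t, x)).1.2 = x₀} :=
        hc.preimage (f := fun t : I => (G (t, x)).1.2) (by fun_prop)
      have hsub : Set.Ioi (0 : I) ⊆ {t : I | (G (t, x)).1.2 = x₀} := fun t ht =>
        key t x (by rw [hx]; exact_mod_cast ht)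
      have h0 : (0 : I) ∈ closure (Set.Ioi (0 : I)) := by
        rw [closure_Ioi' ⟨1, by simp⟩]; exact Set.self_mem_Ici
      have := hcl.closure_subset_iff.2 hsub h0
      simpa [hG0 x] using this
    refine ⟨⟨fun x => 2 * ‖F x‖, by fun_prop⟩, ⟨fun z => (G z).1.2, by fun_prop⟩, ?_, ?_, ?_, ?_⟩
    · have : F x₀ = 0 := by ext t; rw [hF, hG1']; simp
      simp [this]
    · intro x; simp
    · intro x; simp [hG0]
    · intro t x htx
      simp only [ContinuousMap.coe_mk] at htx ⊢
      rcases (norm_nonneg (F x)).eq_or_lt with h0 | h0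
      · rw [hzero x h0.symm, hG1']
      · exact key t x (by linarith)
  · rintro ⟨v, h, hv0, hv, hh0, hh1⟩
    have hvz : ∀ x, v x = 0 → x = x₀ := fun x hx => by
      rw [← hh0 x]; exact hh1 0 x (by simp [hx])
    refine ⟨?_, ?_⟩
    · have : ({x₀} : Set X) = v ⁻¹' {0} := by
        ext x; exact ⟨fun hx => by rw [Set.mem_singleton_iff.1 hx]; exact hv0, hvz x⟩
      rw [this]; exact isClosed_singleton.preimage v.continuous
    · intro Z _ g H hH
      refine ⟨⟨fun z => if (z.1 : ℝ) ≤ v z.2 then g (h z) else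
        H (Set.projIcc 0 1 zero_le_one ((z.1 : ℝ) - v z.2), PUnit.unit), ?_⟩, ?_, ?_⟩
      · refine Continuous.if_le (by fun_prop) ?_ (by fun_prop) (by fun_prop) ?_
        · exact H.continuous.comp ((continuous_projIcc.comp (by fun_prop)).prodMk continuous_const)
        · rintro ⟨t, x⟩ htx
          simp only at htx
          rw [hh1 t x htx.ge, htx, sub_self, Set.projIcc_left]
          exact (hH PUnit.unit).symm
      · intro x; simp [hv x, hh0]
      · rintro t ⟨⟩
        simp only [ContinuousMap.const_apply, ContinuousMap.coe_mk, hv0, sub_zero,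
          Set.projIcc_val]
        split_ifs with ht
        · have : t = 0 := le_antisymm (by exact_mod_cast ht) t.2.1
          rw [this, hh0]; exact (hH PUnit.unit).symm
        · rfl

/-- A well-pointed topological space. -/
structure WPSpace : Type (u + 1) where
  /-- the underlying space -/
  carrier : Type u
  /-- its topology -/
  [top : TopologicalSpace carrier]
  /-- the base point -/
  pt : carrier
  /-- its inclusion is a closed cofibration -/
  isWellPointed : IsWellPointed pt

instance : CoeSort WPSpace.{u} (Type u) := ⟨WPSpace.carrier⟩

instance (X : WPSpace.{u}) : TopologicalSpace X := X.top

/-- A continuous map preserving base points. -/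
@[ext]
structure WPMap (X Y : WPSpace.{u}) where
  /-- the underlying continuous map -/
  map : C(X, Y)
  /-- it preserves the base points -/
  map_pt : map X.pt = Y.pt

namespace WPMap

variable {X Y Z : WPSpace.{u}}

/-- The identity map. -/
def id (X : WPSpace.{u}) : WPMap X X := ⟨.id X, rfl⟩

/-- Composition of pointed maps. -/
def comp (g : WPMap Y Z) (f : WPMap X Y) : WPMap X Z :=
  ⟨g.map.comp f.map, by simp [f.map_pt, g.map_pt]⟩

/-- Pointed homotopies, i.e. homotopies which are stationary at the base point. -/
abbrev Homotopy (f g : WPMap X Y) : Type u := f.map.HomotopyRel g.map {X.pt}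

/-- Two pointed maps are homotopic through pointed maps. -/
def Homotopic (f g : WPMap X Y) : Prop := Nonempty (Homotopy f g)

/-- `f` is a pointed homotopy equivalence. -/
def IsHomotopyEquiv (f : WPMap X Y) : Prop :=
  ∃ g : WPMap Y X, (g.comp f).Homotopic (id X) ∧ (f.comp g).Homotopic (id Y)

end WPMap

namespace WPSpace

/-- The product of two well-pointed spaces. -/
def prod (X Y : WPSpace.{u}) : WPSpace.{u} where
  carrier := X × Y
  pt := (X.pt, Y.pt)
  isWellPointed := by
    obtain ⟨v, h, hv0, hv, hh0, hh1⟩ := (isWellPointed_iff _).1 X.isWellPointed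
    obtain ⟨w, k, hw0, hw, hk0, hk1⟩ := (isWellPointed_iff _).1 Y.isWellPointed
    refine (isWellPointed_iff _).2 ⟨⟨fun z => max (v z.1) (w z.2), by fun_prop⟩,
      ⟨fun z => (h (z.1, z.2.1), k (z.1, z.2.2)), by fun_prop⟩, ?_, ?_, ?_, ?_⟩
    · simp [hv0, hw0]
    · intro x; exact le_max_of_le_left (hv _)
    · intro x; simp [hh0, hk0]
    · intro t x htx
      have := max_le_iff.1 htx
      simp [hh1 t _ this.1, hk1 t _ this.2]

end WPSpace

/-- The pointed map `(f, g) : X → Y × Z`. -/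
def WPMap.prodMk {X Y Z : WPSpace.{u}} (f : WPMap X Y) (g : WPMap X Z) : WPMap X (Y.prod Z) :=
  ⟨f.map.prodMk g.map, Prod.ext f.map_pt g.map_pt⟩

section Pointed

variable {X Y A P : WPSpace.{u}}

/-- The path `[-1, 2] → Y` made of the reverse of `f (h (-, x))`, of `γ`, and of `ι (k (-, a))`. -/
def longPath (f : C(X, Y)) (ι : C(A, Y)) (h : C(I × X, X)) (k : C(I × A, A))
    (z : ℝ × StdPullback f ι) : Y :=
  if z.1 ≤ 0 then f (h (Set.projIcc 0 1 zero_le_one (-z.1), z.2.1.1))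
  else if z.1 ≤ 1 then z.2.1.2.1 (Set.projIcc 0 1 zero_le_one z.1)
  else ι (k (Set.projIcc 0 1 zero_le_one (z.1 - 1), z.2.1.2.2))

theorem continuous_longPath (f : C(X, Y)) (ι : C(A, Y)) (h : C(I × X, X))
    (k : C(I × A, A)) (hh : ∀ x, h (0, x) = x) (hk : ∀ a, k (0, a) = a) :
    Continuous (longPath f ι h k) := by
  have hp : Continuous (Set.projIcc (0 : ℝ) 1 zero_le_one) := continuous_projIcc
  refine Continuous.if_le (by fun_prop) (Continuous.if_le (by fun_prop) (by fun_prop)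
    (by fun_prop) (by fun_prop) ?_) (by fun_prop) (by fun_prop) ?_
  · rintro ⟨r, z⟩ hr
    simp only at hr
    subst hr
    simp [hk, z.2.2]
  · rintro ⟨r, z⟩ hr
    simp only at hr
    subst hr
    simp [hh, z.2.1]

/-- The standard homotopy pullback of two pointed maps between well-pointed spaces, based at the
constant path. -/
def WPSpace.stdPullback (f : WPMap X Y) (ι : WPMap A Y) : WPSpace.{u} where
  carrier := StdPullback f.map ι.map
  pt := ⟨(X.pt, .const _ Y.pt, A.pt), f.map_pt.symm, ι.map_pt.symm⟩
  isWellPointed := by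
    obtain ⟨v, h, hv0, hv, hh0, hh1⟩ := (isWellPointed_iff _).1 X.isWellPointed
    obtain ⟨w, k, hw0, hw, hk0, hk1⟩ := (isWellPointed_iff _).1 A.isWellPointed
    obtain ⟨m, l, hm0, hm, hl0, hl1⟩ := (isWellPointed_iff _).1 Y.isWellPointed
    have hhp : ∀ t, h (t, X.pt) = X.pt := fun t => hh1 t _ (by rw [hv0]; exact t.2.1)
    have hkp : ∀ t, k (t, A.pt) = A.pt := fun t => hk1 t _ (by rw [hw0]; exact t.2.1)
    have hlp : ∀ t, l (t, Y.pt) = Y.pt := fun t => hl1 t _ (by rw [hm0]; exact t.2.1)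
    have hK := continuous_longPath f.map ι.map h k hh0 hk0
    have hpr : Continuous (Set.projIcc (0 : ℝ) 1 zero_le_one) := continuous_projIcc
    -- the largest value of `m` along the long path
    let F : C(StdPullback f.map ι.map, C(I, ℝ)) := ContinuousMap.curry
      ⟨fun z => m (longPath f.map ι.map h k (3 * (z.2 : ℝ) - 1, z.1)), by fun_prop⟩
    have hF : ∀ e (r : ℝ), -1 ≤ r → r ≤ 2 → m (longPath f.map ι.map h k (r, e)) ≤ ‖F e‖ := by
      intro e r h1 h2
      have := (le_abs_self _).trans
        ((F e).norm_coe_le_norm ⟨(r + 1) / 3, by linarith, by linarith⟩)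
      have h3 : 3 * ((r + 1) / 3) - 1 = r := by ring
      simpa [F, h3] using this
    have hend0 : ∀ (t : I) e, longPath f.map ι.map h k (-t, e) = f.map (h (t, e.1.1)) := by
      intro t e
      have : (-(t : ℝ)) ≤ 0 := neg_nonpos.2 t.2.1
      simp [longPath, this]
    have hend1 : ∀ (t : I) e, longPath f.map ι.map h k (1 + t, e) = ι.map (k (t, e.1.2.2)) := by
      intro t e
      have h0 := t.2.1
      have h1 : ¬ (1 + (t : ℝ)) ≤ 0 := by linarith
      rcases h0.eq_or_lt with ht | ht
      · have ht' : t = 0 := Subtype.ext ht.symm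
        subst ht'
        simp [longPath, hk0, e.2.2]
      · have h2 : ¬ (1 + (t : ℝ)) ≤ 1 := by linarith
        simp only [longPath, h1, h2, if_false, add_sub_cancel_left, Set.projIcc_val]
    let d : StdPullback f.map ι.map → ℝ := fun e => max (v e.1.1) (w e.1.2.2)
    have hd : Continuous d := by fun_prop
    let c : I × StdPullback f.map ι.map → I := fun z =>
      Set.projIcc 0 1 zero_le_one ((z.1 : ℝ) - d z.2)
    have hc : Continuous c := by fun_prop
    have hc0 : ∀ z, (z.1 : ℝ) ≤ d z.2 → c z = 0 := fun z hz =>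
      Set.projIcc_of_le_left _ (by linarith)
    let D : C(I × StdPullback f.map ι.map, C(I, Y)) := ContinuousMap.curry
      ⟨fun z => l (c z.1, longPath f.map ι.map h k
        ((z.2 : ℝ) * (1 + 2 * (z.1.1 : ℝ)) - z.1.1, z.1.2)), by fun_prop⟩
    have hD : ∀ z τ, D z τ = l (c z, longPath f.map ι.map h k
      ((τ : ℝ) * (1 + 2 * (z.1 : ℝ)) - z.1, z.2)) := fun z τ => rfl
    have hD0 : ∀ z, D z 0 = f.map (h (z.1, z.2.1.1)) := by
      rintro ⟨t, e⟩
      rw [hD]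
      simp only [Set.Icc.coe_zero, zero_mul, zero_sub, hend0]
      rcases le_total (t : ℝ) (d e) with hle | hle
      · rw [hc0 _ hle, hl0]
      · rw [hh1 t _ ((le_max_left _ _).trans hle), f.map_pt, hlp]
    have hD1 : ∀ z, D z 1 = ι.map (k (z.1, z.2.1.2.2)) := by
      rintro ⟨t, e⟩
      rw [hD]
      have : (1 : ℝ) * (1 + 2 * (t : ℝ)) - t = 1 + t := by ring
      simp only [Set.Icc.coe_one, this, hend1]
      rcases le_total (t : ℝ) (d e) with hle | hle
      · rw [hc0 _ hle, hl0]
      · rw [hk1 t _ ((le_max_right _ _).trans hle), ι.map_pt, hlp]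
    refine (isWellPointed_iff _).2 ⟨⟨fun e => d e + ‖F e‖, by fun_prop⟩,
      ⟨fun z => ⟨(h (z.1, z.2.1.1), D z, k (z.1, z.2.1.2.2)), hD0 z, hD1 z⟩, ?_⟩, ?_, ?_, ?_, ?_⟩
    · exact Continuous.subtype_mk (by fun_prop) _
    · have : F ⟨(X.pt, .const _ Y.pt, A.pt), f.map_pt.symm, ι.map_pt.symm⟩ = 0 := by
        ext t
        simp [F, longPath, hhp, hkp, f.map_pt, ι.map_pt, hm0]
      simp [d, hv0, hw0, this]
    · intro e
      exact add_nonneg (le_max_of_le_left (hv _)) (norm_nonneg _)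
    · intro e
      refine Subtype.ext (Prod.ext (hh0 _) (Prod.ext (ContinuousMap.ext fun τ => ?_) (hk0 _)))
      change D (0, e) τ = e.1.2.1 τ
      rw [hD, hc0 _ (le_max_of_le_left (hv _)), hl0]
      have h1 := τ.2.1
      have h2 := τ.2.2
      simp only [Set.Icc.coe_zero, mul_zero, add_zero, mul_one, sub_zero, longPath, h2, if_true,
        Set.projIcc_val]
      split_ifs with h0
      · have : τ = 0 := Subtype.ext (le_antisymm h0 h1)
        subst this
        simp [hh0, e.2.1]
      · rfl
    · intro t e hte
      simp only [ContinuousMap.coe_mk] at hte ⊢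
      have hdt : d e ≤ t := le_trans (by simp) hte
      refine Subtype.ext (Prod.ext (hh1 _ _ ((le_max_left _ _).trans hdt))
        (Prod.ext (ContinuousMap.ext fun τ => ?_) (hk1 _ _ ((le_max_right _ _).trans hdt))))
      change D (t, e) τ = Y.pt
      rw [hD]
      have ht0 := t.2.1
      have ht1 := t.2.2
      have h0 := τ.2.1
      have h1 := τ.2.2
      refine hl1 _ _ ((hF e _ (by nlinarith) (by nlinarith)).trans ?_)
      have hdn : 0 ≤ d e := le_max_of_le_left (hv _)
      have : c (t, e) = ⟨(t : ℝ) - d e, by linarith, by linarith⟩ :=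
        Set.projIcc_of_mem zero_le_one ⟨by linarith, by linarith⟩
      rw [this]
      change ‖F e‖ ≤ (t : ℝ) - d e
      linarith

/-- The projection of the standard homotopy pullback to `X`. -/
def WPSpace.stdPullbackFst (f : WPMap X Y) (ι : WPMap A Y) :
    WPMap (WPSpace.stdPullback f ι) X :=
  ⟨StdPullback.fst f.map ι.map, rfl⟩

/-- A pointed homotopy `H` from `f ∘ q` to `ι ∘ p` induces a pointed map into the standard homotopy
pullback, `z ↦ (q z, H(-, z), p z)`. -/
def WPMap.whisker {f : WPMap X Y} {ι : WPMap A Y} {q : WPMap P X} {p : WPMap P A}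
    (H : (f.comp q).Homotopy (ι.comp p)) : WPMap P (WPSpace.stdPullback f ι) where
  map := LiftCat.whisker H.toHomotopy
  map_pt := by
    refine Subtype.ext (Prod.ext q.map_pt (Prod.ext (ContinuousMap.ext fun t => ?_) p.map_pt))
    exact (H.eq_fst t rfl).trans (f.comp q).map_pt

/-- Homotopy pullback squares of well-pointed spaces. -/
def IsWPHomotopyPullback (q : WPMap P X) (p : WPMap P A) (f : WPMap X Y) (ι : WPMap A Y) : Prop :=
  ∃ H : (f.comp q).Homotopy (ι.comp p), (WPMap.whisker H).IsHomotopyEquiv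

end Pointed

/-- An abstract sectional category on well-pointed spaces and pointed continuous maps. -/
structure WPSectionalCategory where
  /-- the number attached to each map -/
  secat : ∀ {A Y : WPSpace.{u}}, WPMap A Y → ℕ∞
  /-- S0: it vanishes exactly on the maps with a homotopy section. -/
  secat_eq_zero_iff : ∀ {A Y : WPSpace.{u}} (ι : WPMap A Y),
    secat ι = 0 ↔ ∃ s : WPMap Y A, (ι.comp s).Homotopic (WPMap.id Y)
  /-- S1: monotonicity over a fixed base. -/
  secat_le_of_triangle : ∀ {A B X : WPSpace.{u}} (ι : WPMap A X) (κ : WPMap B X) (ζ : WPMap B A),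
    (ι.comp ζ).Homotopic κ → secat ι ≤ secat κ
  /-- S2: monotonicity under base change. -/
  secat_le_of_isHomotopyPullback : ∀ {P X Y A : WPSpace.{u}} (q : WPMap P X) (p : WPMap P A)
    (f : WPMap X Y) (ι : WPMap A Y), IsWPHomotopyPullback q p f ι → secat q ≤ secat ι

namespace WPSectionalCategory

variable (S : WPSectionalCategory.{u}) {X Y A P : WPSpace.{u}}

/-- The lifting category from `f` to `ι`: the sectional category of the base change of `ι`
along `f` in the standard homotopy pullback. -/
def liftcat (f : WPMap X Y) (ι : WPMap A Y) : ℕ∞ := S.secat (WPSpace.stdPullbackFst f ι)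

/-- The lifting category may be computed with any homotopy pullback. -/
theorem liftcat_eq_secat {q : WPMap P X} {p : WPMap P A} {f : WPMap X Y} {ι : WPMap A Y}
    (h : IsWPHomotopyPullback q p f ι) : S.liftcat f ι = S.secat q := by
  obtain ⟨H, v, -, hv⟩ := h
  refine le_antisymm (S.secat_le_of_triangle _ _ (WPMap.whisker H) ⟨.refl _ _⟩)
    (S.secat_le_of_triangle _ _ v ?_)
  exact ContinuousMap.HomotopicRel.comp_continuousMap hv (WPSpace.stdPullbackFst f ι).map

/-- The homotopic distance, i.e. the lifting category from `(f, g) : X → Y × Y` to the diagonal. -/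
def homDist (f g : WPMap X Y) : ℕ∞ :=
  S.liftcat (f.prodMk g) ((WPMap.id Y).prodMk (WPMap.id Y))

end WPSectionalCategory

end LiftCat

end

/-!
The homotopy pullback `q : P → X` of `(f, g) : X → Y × Y` and the diagonal is a weak equalizer of
`f` and `g` up to homotopy: `f ∘ q ≃ g ∘ q`, and every `a` with `f ∘ a ≃ g ∘ a` factors through `q`
up to homotopy. Hence `q` has a homotopy section if and only if `f ≃ g`, which by (S0) is the first
claim. Being a weak equalizer is symmetric in `f` and `g`, and (S1) shows that any two weak
equalizers of the same pair have the same sectional category, which is the second claim.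
-/

open CategoryTheory

namespace LiftCat

section Abstract

variable {C : Type*} [Category* C]

/-- `q` is a weak equalizer of `f` and `g` up to the relation `r`, which plays the role of homotopy:
it equalizes `f` and `g`, and all maps equalizing `f` and `g` factor through it, where
factorizations need not be unique and all equations hold only up to `r`. -/
structure IsWeakEqualizer (r : HomRel C) {P X Y : C} (q : P ⟶ X) (f g : X ⟶ Y) : Prop where
  condition : r (q ≫ f) (q ≫ g)
  exists_lift : ∀ {W : C} (a : W ⟶ X), r (a ≫ f) (a ≫ g) → ∃ w : W ⟶ P, r (w ≫ q) a

/-- The part (S0), (S1) of an abstract sectional category that makes sense in any category, with `r`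
in the role of homotopy. -/
structure AbstractSecat (r : HomRel C) where
  /-- the number attached to each map -/
  secat : ∀ {A Y : C}, (A ⟶ Y) → ℕ∞
  /-- S0: it vanishes exactly on the maps with a section up to `r`. -/
  secat_eq_zero_iff : ∀ {A Y : C} (ι : A ⟶ Y), secat ι = 0 ↔ ∃ s : Y ⟶ A, r (s ≫ ι) (𝟙 Y)
  /-- S1: monotonicity over a fixed base. -/
  secat_le_of_triangle : ∀ {A B X : C} (ι : A ⟶ X) (κ : B ⟶ X) (ζ : B ⟶ A),
    r (ζ ≫ ι) κ → secat ι ≤ secat κ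

variable {r : HomRel C} {P P' X Y : C} {q : P ⟶ X} {q' : P' ⟶ X} {f g : X ⟶ Y}

theorem AbstractSecat.secat_le_of_isWeakEqualizer (S : AbstractSecat r)
    (h : IsWeakEqualizer r q f g) (h' : r (q' ≫ f) (q' ≫ g)) : S.secat q ≤ S.secat q' := by
  obtain ⟨w, hw⟩ := h.exists_lift q' h'
  exact S.secat_le_of_triangle q q' w hw

theorem AbstractSecat.secat_eq_of_isWeakEqualizer (S : AbstractSecat r)
    (h : IsWeakEqualizer r q f g) (h' : IsWeakEqualizer r q' f g) : S.secat q = S.secat q' :=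
  le_antisymm (S.secat_le_of_isWeakEqualizer h h'.condition)
    (S.secat_le_of_isWeakEqualizer h' h.condition)

variable [Congruence r]

theorem IsWeakEqualizer.symm (h : IsWeakEqualizer r q f g) : IsWeakEqualizer r q g f where
  condition := Congruence.equivalence.symm h.condition
  exists_lift a ha := h.exists_lift a (Congruence.equivalence.symm ha)

theorem IsWeakEqualizer.exists_section_iff (h : IsWeakEqualizer r q f g) :
    (∃ s : X ⟶ P, r (s ≫ q) (𝟙 X)) ↔ r f g := by
  have equiv : Equivalence (@r X Y) := Congruence.equivalence
  constructor
  · rintro ⟨s, hs⟩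
    have factor (k : X ⟶ Y) : r (s ≫ q ≫ k) k := by
      simpa only [Category.assoc, Category.id_comp] using HomRel.comp_right k hs
    exact equiv.trans (equiv.symm (factor f))
      (equiv.trans (HomRel.comp_left s h.condition) (factor g))
  · intro hfg
    exact h.exists_lift (𝟙 X) (by simpa only [Category.id_comp] using hfg)

theorem AbstractSecat.secat_eq_zero_iff_of_isWeakEqualizer (S : AbstractSecat r)
    (h : IsWeakEqualizer r q f g) : S.secat q = 0 ↔ r f g :=
  (S.secat_eq_zero_iff q).trans h.exists_section_iff

end Abstract

section Free

variable {X Y A : Type u} [TopologicalSpace X] [TopologicalSpace Y] [TopologicalSpace A]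

/-- The projection of the standard homotopy pullback to `A`. -/
def StdPullback.snd (f : C(X, Y)) (ι : C(A, Y)) : C(StdPullback f ι, A) where
  toFun z := z.1.2.2

/-- The tautological homotopy `(t, (x, γ, a)) ↦ γ t` filling the standard homotopy pullback
square. -/
def StdPullback.homotopy (f : C(X, Y)) (ι : C(A, Y)) :
    (f.comp (StdPullback.fst f ι)).Homotopy (ι.comp (StdPullback.snd f ι)) where
  toFun z := z.2.1.2.1 z.1
  map_zero_left z := z.2.1
  map_one_left z := z.2.2

/-- Homotopy of continuous maps, as a relation on the morphisms of `TopCat`. -/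
def topHomotopic : HomRel TopCat.{u} := fun _ _ f g => f.hom.Homotopic g.hom

instance : Congruence topHomotopic.{u} where
  comp_left f _ _ h := ContinuousMap.Homotopic.comp h (.refl f.hom)
  comp_right g h := ContinuousMap.Homotopic.comp (.refl g.hom) h
  equivalence := ⟨fun f => .refl f.hom, fun h => h.symm, fun h h' => h.trans h'⟩

theorem isWeakEqualizer_stdPullbackFst (f g : C(X, Y)) :
    IsWeakEqualizer topHomotopic
      (TopCat.ofHom (StdPullback.fst (f.prodMk g) ((ContinuousMap.id Y).prodMk (.id Y))))
      (TopCat.ofHom f) (TopCat.ofHom g) where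
  condition := by
    let H := StdPullback.homotopy (f.prodMk g) ((ContinuousMap.id Y).prodMk (.id Y))
    have hf : (f.comp (StdPullback.fst _ _)).Homotopic (StdPullback.snd _ _) :=
      .comp (.refl ContinuousMap.fst) ⟨H⟩
    have hg : (g.comp (StdPullback.fst _ _)).Homotopic (StdPullback.snd _ _) :=
      .comp (.refl ContinuousMap.snd) ⟨H⟩
    exact hf.trans hg.symm
  exists_lift a := by
    rintro ⟨H⟩
    let K : ((f.prodMk g).comp a.hom).Homotopy
        (((ContinuousMap.id Y).prodMk (.id Y)).comp (g.comp a.hom)) :=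
      H.prodMk (.refl (g.comp a.hom))
    exact ⟨TopCat.ofHom (whisker K), .refl a.hom⟩

/-- The axioms (S0) and (S1) of `S`, read in `TopCat`. -/
def SectionalCategory.toAbstractSecat (S : SectionalCategory.{u}) :
    AbstractSecat topHomotopic.{u} where
  secat ι := S.secat ι.hom
  secat_eq_zero_iff ι := (S.secat_eq_zero_iff ι.hom).trans
    ⟨fun ⟨s, hs⟩ => ⟨TopCat.ofHom s, hs⟩, fun ⟨s, hs⟩ => ⟨s.hom, hs⟩⟩
  secat_le_of_triangle ι κ ζ := S.secat_le_of_triangle ι.hom κ.hom ζ.hom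

end Free

section Pointed

variable {X Y Z A : WPSpace.{u}}

instance : Category WPSpace.{u} where
  Hom := WPMap
  id := WPMap.id
  comp f g := g.comp f

namespace WPMap

theorem Homotopic.postcomp {f g : WPMap X Y} (h : f.Homotopic g) (k : WPMap Y Z) :
    (k.comp f).Homotopic (k.comp g) :=
  ContinuousMap.HomotopicRel.comp_continuousMap h k.map

theorem Homotopic.precomp {f g : WPMap Y Z} (h : f.Homotopic g) (k : WPMap X Y) :
    (f.comp k).Homotopic (g.comp k) := by
  obtain ⟨H⟩ := h
  refine ⟨⟨H.toHomotopy.compContinuousMap k.map, ?_⟩⟩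
  rintro t x rfl
  exact H.eq_fst t k.map_pt

/-- The first projection of a product of well-pointed spaces. -/
def fst : WPMap (X.prod Y) X := ⟨ContinuousMap.fst, rfl⟩

/-- The second projection of a product of well-pointed spaces. -/
def snd : WPMap (X.prod Y) Y := ⟨ContinuousMap.snd, rfl⟩

end WPMap

/-- The projection of the standard homotopy pullback of pointed maps to `A`. -/
def WPSpace.stdPullbackSnd (f : WPMap X Y) (ι : WPMap A Y) :
    WPMap (WPSpace.stdPullback f ι) A :=
  ⟨StdPullback.snd f.map ι.map, rfl⟩

theorem WPSpace.stdPullback_homotopic (f : WPMap X Y) (ι : WPMap A Y) :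
    (f.comp (WPSpace.stdPullbackFst f ι)).Homotopic (ι.comp (WPSpace.stdPullbackSnd f ι)) := by
  refine ⟨⟨StdPullback.homotopy f.map ι.map, ?_⟩⟩
  rintro t x rfl
  exact f.map_pt.symm

/-- Pointed homotopy, as a relation on the morphisms of the category of well-pointed spaces. -/
def wpHomotopic : HomRel WPSpace.{u} := fun _ _ f g => WPMap.Homotopic f g

instance : Congruence wpHomotopic.{u} where
  comp_left f _ _ h := WPMap.Homotopic.precomp h f
  comp_right g h := WPMap.Homotopic.postcomp h g
  equivalence := ⟨fun f => ContinuousMap.HomotopicRel.refl f.map,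
    fun h => ContinuousMap.HomotopicRel.symm h, fun h h' => ContinuousMap.HomotopicRel.trans h h'⟩

theorem isWeakEqualizer_wpStdPullbackFst (f g : WPMap X Y) :
    IsWeakEqualizer wpHomotopic
      (WPSpace.stdPullbackFst (f.prodMk g) ((WPMap.id Y).prodMk (WPMap.id Y))) f g where
  condition := by
    have square := WPSpace.stdPullback_homotopic (f.prodMk g) ((WPMap.id Y).prodMk (WPMap.id Y))
    have hf : (f.comp (WPSpace.stdPullbackFst _ _)).Homotopic
        (WPSpace.stdPullbackSnd _ _) := square.postcomp WPMap.fst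
    have hg : (g.comp (WPSpace.stdPullbackFst _ _)).Homotopic
        (WPSpace.stdPullbackSnd _ _) := square.postcomp WPMap.snd
    exact ContinuousMap.HomotopicRel.trans hf (.symm hg)
  exists_lift a := by
    rintro ⟨H⟩
    let K : ((f.prodMk g).comp a).Homotopy
        (((WPMap.id Y).prodMk (WPMap.id Y)).comp (g.comp a)) := H.prod (.refl (g.comp a).map _)
    exact ⟨WPMap.whisker K, ContinuousMap.HomotopicRel.refl a.map⟩

/-- The axioms (S0) and (S1) of `S`, read in the category of well-pointed spaces. -/
def WPSectionalCategory.toAbstractSecat (S : WPSectionalCategory.{u}) :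
    AbstractSecat wpHomotopic.{u} where
  secat := S.secat
  secat_eq_zero_iff := S.secat_eq_zero_iff
  secat_le_of_triangle := S.secat_le_of_triangle

end Pointed

end LiftCat

theorem mainTheorem8_general {C : Type*} [Category* C] {r : HomRel C} [Congruence r]
    (S : LiftCat.AbstractSecat r) {P P' X Y : C} {q : P ⟶ X} {q' : P' ⟶ X} {f g : X ⟶ Y}
    (hq : LiftCat.IsWeakEqualizer r q f g) (hq' : LiftCat.IsWeakEqualizer r q' g f) :
    (S.secat q = 0 ↔ r f g) ∧ S.secat q = S.secat q' :=
  ⟨S.secat_eq_zero_iff_of_isWeakEqualizer hq, S.secat_eq_of_isWeakEqualizer hq hq'.symm⟩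

theorem mainTheorem8 :
    (∀ (S : LiftCat.SectionalCategory.{u}) (X Y : Type u) [TopologicalSpace X] [TopologicalSpace Y]
      (f g : C(X, Y)),
      (S.homDist f g = 0 ↔ f.Homotopic g) ∧ S.homDist f g = S.homDist g f) ∧
    (∀ (S : LiftCat.WPSectionalCategory.{u}) (X Y : LiftCat.WPSpace.{u}) (f g : LiftCat.WPMap X Y),
      (S.homDist f g = 0 ↔ f.Homotopic g) ∧ S.homDist f g = S.homDist g f) := by
  exact ⟨fun S _ _ _ _ f g => mainTheorem8_general S.toAbstractSecat
      (LiftCat.isWeakEqualizer_stdPullbackFst f g) (LiftCat.isWeakEqualizer_stdPullbackFst g f),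
    fun S _ _ f g => mainTheorem8_general S.toAbstractSecat
      (LiftCat.isWeakEqualizer_wpStdPullbackFst f g) (LiftCat.isWeakEqualizer_wpStdPullbackFst g f)⟩
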